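/- Let $s>0$ and let $z_1,z_2,z_3,z_4\in\mathbb R^3$ satisfy $|z_j-z_{j'}|=s$ for all $j\ne j'$ (the vertices of a regular tetrahedron with side $s$), and let $\alpha_1=\dots=\alpha_4=\alpha=-(4\pi s)^{-1}$. Consider the stationary Schrödinger equation $-\Delta\psi+v\psi=E\psi$ in $\mathbb R^3$, where $v=\sum_{j=1}^4 v_{z_j,\alpha_j}$ is the multipoint scatterer consisting of single-point scatterers with positions $z_j$ and internal parameters $\alpha_j$; by definition, a complex-valued function $\psi$ satisfies this equation if and only if $$-\Delta\psi(x)=E\psi(x)\quad\text{for } x\in\mathbb R^3\setminus\{z_1,\dots,z_4\}$$ (with $\psi$ of class $C^2$ there) and, for each $j$, there are constants $\psi_{j,-1},\psi_{j,0}\in\mathbb C$ with $$\psi(x)=\frac{\psi_{j,-1}}{|x-z_j|}+\psi_{j,0}+O(|x-z_j|)\quad\text{as } x\to z_j,\qquad \psi_{j,0}=4\pi\alpha_j\,\psi_{j,-1}.$$ Then $E=0$ is an eigenvalue of multiplicity exactly three for this equation: the complex vector space of solutions $\psi\in L^2(\mathbb R^3)$ at energy $E=0$ is three-dimensional. -/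

import Mathlib

open MeasureTheory Filter Topology Asymptotics
open scoped Laplacian

noncomputable section

namespace PointScatterers

/-- Three-dimensional Euclidean space. -/
abbrev R3 : Type := EuclideanSpace ℝ (Fin 3)

/-- `ψ` solves `-Δψ + v ψ = E ψ` in `ℝ³`, where `v` is the multipoint scatterer with
positions `z j` and internal parameters `α j`: away from the points `z j`, `ψ` is a classical
(`C²`) solution of the free equation, and
`ψ(x) = ψ_{j,-1} / |x - z_j| + ψ_{j,0} + O(|x - z_j|)` as `x → z_j` (`x ≠ z_j`), with
`ψ_{j,0} = 4 π α_j ψ_{j,-1}`.  The values of `ψ` at the points `z j` play no role. -/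
structure IsSolution {n : ℕ} (z : Fin n → R3) (α : Fin n → ℝ) (E : ℝ) (ψ : R3 → ℂ) : Prop where
  contDiffOn : ContDiffOn ℝ 2 ψ (Set.range z)ᶜ
  free_eq : ∀ x ∈ (Set.range z)ᶜ, -(Δ ψ) x = (E : ℂ) * ψ x
  asymptotics : ∀ j : Fin n, ∃ a b : ℂ,
    (fun x : R3 => ψ x - (a / (‖x - z j‖ : ℂ) + b)) =O[𝓝[≠] (z j)] (fun x => ‖x - z j‖) ∧
    b = 4 * (Real.pi : ℂ) * (α j : ℂ) * a

theorem isOpen_compl_range {n : ℕ} (z : Fin n → R3) : IsOpen (Set.range z)ᶜ :=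
  (Set.finite_range z).isClosed.isOpen_compl

theorem IsSolution.zero {n : ℕ} (z : Fin n → R3) (α : Fin n → ℝ) (E : ℝ) :
    IsSolution z α E (0 : R3 → ℂ) where
  contDiffOn := contDiffOn_const
  free_eq x _ := by
    have h : Δ (0 : R3 → ℂ) x = 0 := by
      simpa using InnerProductSpace.laplacian_smul (0 : ℝ)
        (contDiffAt_const (c := (0 : ℂ)) (x := x) (n := 2) (𝕜 := ℝ))
    simp [h]
  asymptotics j := ⟨0, 0, by simpa using isBigO_zero _ _, by simp⟩

theorem IsSolution.add {n : ℕ} {z : Fin n → R3} {α : Fin n → ℝ} {E : ℝ} {ψ φ : R3 → ℂ}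
    (hψ : IsSolution z α E ψ) (hφ : IsSolution z α E φ) : IsSolution z α E (ψ + φ) where
  contDiffOn := hψ.contDiffOn.add hφ.contDiffOn
  free_eq x hx := by
    have hx' := (isOpen_compl_range z).mem_nhds hx
    rw [(hψ.contDiffOn.contDiffAt hx').laplacian_add (hφ.contDiffOn.contDiffAt hx'),
      neg_add, hψ.free_eq x hx, hφ.free_eq x hx, Pi.add_apply, mul_add]
  asymptotics j := by
    obtain ⟨a, b, h, hb⟩ := hψ.asymptotics j
    obtain ⟨a', b', h', hb'⟩ := hφ.asymptotics j
    refine ⟨a + a', b + b', ?_, by rw [hb, hb']; ring⟩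
    refine (h.add h').congr_left fun x => ?_
    simp only [Pi.add_apply]
    ring

theorem IsSolution.smul {n : ℕ} {z : Fin n → R3} {α : Fin n → ℝ} {E : ℝ} {ψ : R3 → ℂ}
    (c : ℂ) (hψ : IsSolution z α E ψ) : IsSolution z α E (c • ψ) where
  contDiffOn := hψ.contDiffOn.const_smul c
  free_eq x hx := by
    have hx' := (isOpen_compl_range z).mem_nhds hx
    have h : Δ (c • ψ) x = c • Δ ψ x :=
      (hψ.contDiffOn.contDiffAt hx').laplacian_CLM_comp_left
        (l := (ContinuousLinearMap.mul ℝ ℂ c))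
    have h2 := hψ.free_eq x hx
    rw [h, Pi.smul_apply, smul_eq_mul, smul_eq_mul]
    linear_combination c * h2
  asymptotics j := by
    obtain ⟨a, b, h, hb⟩ := hψ.asymptotics j
    refine ⟨c * a, c * b, ?_, by rw [hb]; ring⟩
    refine (h.const_mul_left c).congr_left fun x => ?_
    simp only [Pi.smul_apply, smul_eq_mul]
    ring

/-- The space of solutions in `L²(ℝ³)` at energy `E`: the classes in `L²(ℝ³; ℂ)` that are
represented by a solution. -/
def boundStates {n : ℕ} (z : Fin n → R3) (α : Fin n → ℝ) (E : ℝ) :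
    Submodule ℂ (Lp ℂ 2 (volume : Measure R3)) where
  carrier := {f | ∃ ψ : R3 → ℂ, IsSolution z α E ψ ∧ f =ᵐ[volume] ψ}
  zero_mem' := ⟨0, IsSolution.zero z α E, Lp.coeFn_zero ℂ 2 volume⟩
  add_mem' := by
    rintro f g ⟨ψ, hψ, hf⟩ ⟨φ, hφ, hg⟩
    exact ⟨ψ + φ, hψ.add hφ, (Lp.coeFn_add f g).trans (hf.add hg)⟩
  smul_mem' := by
    rintro c f ⟨ψ, hψ, hf⟩
    exact ⟨c • ψ, hψ.smul c, (Lp.coeFn_smul c f).trans (hf.const_smul c)⟩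

end PointScatterers

end

/-! An `L²` solution at zero energy is harmonic off the points `z j`, and a weighted mean value
property makes it vanish at infinity (`tendsto_cobounded_of_harmonicOnNhd_of_memLp`). Subtracting
the Coulomb potentials with the same singular coefficients leaves a harmonic function bounded at the
punctures and zero at infinity, hence zero by the maximum principle. So `ψ = ∑ q j / |x - z j|` off
the points, and the condition at `z k` reads `∑_{j ≠ k} q j / |z k - z j| = 4 π α q k`.

For the tetrahedron, where `4 π α = -1/s`, all four equations become `∑ q j = 0`
(`charge_condition_iff`). Conversely, neutral charges give `L²` potentials, since `1/|x - a| -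
1/|x|` is `O(|x|⁻²)` at infinity and Coulomb singularities are square integrable in dimension three.
The potential determines the charges through its singularities, so the bound states are isomorphic
to a hyperplane of `ℂ⁴`. -/

open MeasureTheory Filter Topology Asymptotics
open scoped Laplacian

namespace PointScatterers

/-! ### Second-derivative test and the Laplacian -/

section SecondDerivatives

variable {E : Type*} [NormedAddCommGroup E] [InnerProductSpace ℝ E]
  {F : Type*} [NormedAddCommGroup F] [NormedSpace ℝ F]

theorem laplacian_eq_sum_fderiv_fderiv [FiniteDimensional ℝ E] {ι : Type*} [Fintype ι]
    (b : OrthonormalBasis ι ℝ E) (f : E → F) (x : E) :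
    Δ f x = ∑ i, fderiv ℝ (fderiv ℝ f) x (b i) (b i) := by
  rw [InnerProductSpace.laplacian_eq_iteratedFDeriv_orthonormalBasis f b]
  simp [iteratedFDeriv_two_apply]

/-- The second derivative of a `C²` function at a local maximum is negative semidefinite. -/
theorem fderiv_fderiv_nonpos_of_isLocalMax {f : E → ℝ} {x : E} (hf : ContDiffAt ℝ 2 f x)
    (hx : IsLocalMax f x) (v : E) : fderiv ℝ (fderiv ℝ f) x v v ≤ 0 := by
  by_contra! hpos
  set g : ℝ → ℝ := fun t => f (x + t • v) with hg
  have hline : ∀ t : ℝ, HasDerivAt (fun t : ℝ => x + t • v) v t := fun t => by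
    simpa using ((hasDerivAt_id t).smul_const v).const_add x
  have hcont : Tendsto (fun t : ℝ => x + t • v) (𝓝 0) (𝓝 x) := by
    have := (hline 0).continuousAt.tendsto
    simpa using this
  have hdiff : ∀ᶠ y in 𝓝 x, DifferentiableAt ℝ f y := by
    filter_upwards [hf.eventually (by simp)] with y hy
    exact hy.differentiableAt (by simp)
  have hd1 : deriv g =ᶠ[𝓝 0] fun t => fderiv ℝ f (x + t • v) v := by
    filter_upwards [hcont.eventually hdiff] with t ht
    exact (ht.hasFDerivAt.comp_hasDerivAt t (hline t)).deriv
  have hd2 : deriv (deriv g) 0 = fderiv ℝ (fderiv ℝ f) x v v := by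
    rw [hd1.deriv_eq]
    have h2 : HasFDerivAt (fderiv ℝ f) (fderiv ℝ (fderiv ℝ f) x) (x + (0 : ℝ) • v) := by
      rw [zero_smul, add_zero]
      exact ((hf.fderiv_right (m := 1) (by norm_num)).differentiableAt one_ne_zero).hasFDerivAt
    have h3 : HasDerivAt (fun t : ℝ => fderiv ℝ f (x + t • v)) (fderiv ℝ (fderiv ℝ f) x v) 0 :=
      h2.comp_hasDerivAt (0 : ℝ) (hline 0)
    exact ((ContinuousLinearMap.apply ℝ ℝ v).hasFDerivAt.comp_hasDerivAt (0 : ℝ) h3).deriv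
  have hgmax : IsLocalMax g 0 := by
    have := hcont.eventually hx
    simpa [IsLocalMax, IsMaxFilter, hg] using this
  have hgc : ContinuousAt g 0 := by
    have : ContinuousAt f (x + (0 : ℝ) • v) := by simpa using hf.continuousAt
    exact ContinuousAt.comp (g := f) this (hline 0).continuousAt
  -- A positive second derivative makes the local maximum also a local minimum, so `g` is locally
  -- constant: a contradiction.
  have hgmin : IsLocalMin g 0 :=
    isLocalMin_of_deriv_deriv_pos (hd2 ▸ hpos) hgmax.deriv_eq_zero hgc
  have hgconst : g =ᶠ[𝓝 0] fun _ => g 0 := by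
    filter_upwards [hgmax, hgmin] with t h1 h2 using le_antisymm h1 h2
  have h0 : deriv (deriv g) 0 = 0 := by
    rw [hgconst.deriv.deriv_eq]
    simp
  rw [← hd2, h0] at hpos
  exact lt_irrefl _ hpos

theorem laplacian_nonpos_of_isLocalMax [FiniteDimensional ℝ E] {f : E → ℝ} {x : E}
    (hf : ContDiffAt ℝ 2 f x) (hx : IsLocalMax f x) : Δ f x ≤ 0 := by
  rw [laplacian_eq_sum_fderiv_fderiv (stdOrthonormalBasis ℝ E)]
  exact Finset.sum_nonpos fun i _ => fderiv_fderiv_nonpos_of_isLocalMax hf hx _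

/-- Supplies the strictly subharmonic perturbation in the maximum principle. -/
theorem laplacian_norm_sq [FiniteDimensional ℝ E] (x : E) :
    Δ (fun y : E => ‖y‖ ^ 2) x = 2 * Module.finrank ℝ E := by
  have h1 : fderiv ℝ (fun y : E => ‖y‖ ^ 2) = fun y => (2 : ℝ) • innerSL ℝ y := by
    ext1 y
    rw [(hasStrictFDerivAt_norm_sq y).hasFDerivAt.fderiv, two_smul, two_smul]
  have h2 : fderiv ℝ (fun y : E => (2 : ℝ) • innerSL ℝ y) x = (2 : ℝ) • innerSL ℝ :=
    ((innerSL ℝ (E := E)).hasFDerivAt.const_smul (2 : ℝ)).fderiv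
  rw [laplacian_eq_sum_fderiv_fderiv (stdOrthonormalBasis ℝ E), h1, h2]
  have h3 (i : Fin (Module.finrank ℝ E)) :
      ((2 : ℝ) • innerSL ℝ (E := E)) (stdOrthonormalBasis ℝ E i) (stdOrthonormalBasis ℝ E i) = 2 := by
    rw [smul_apply, smul_apply, innerSL_apply_apply,
      real_inner_self_eq_norm_sq, (stdOrthonormalBasis ℝ E).norm_eq_one]
    norm_num
  rw [Finset.sum_congr rfl fun i _ => h3 i]
  simp [mul_comm]

end SecondDerivatives

/-! ### Harmonicity of the Coulomb potential -/

section Newtonian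

theorem hasFDerivAt_inv_norm_pow {E : Type*} [NormedAddCommGroup E] [InnerProductSpace ℝ E]
    {x : E} (hx : x ≠ 0) (n : ℕ) :
    HasFDerivAt (fun y : E => (‖y‖ ^ n)⁻¹) (-((n : ℝ) * (‖x‖ ^ (n + 2))⁻¹) • innerSL ℝ x) x := by
  have hx' : ‖x‖ ≠ 0 := norm_ne_zero_iff.2 hx
  have hn : HasFDerivAt (fun y : E => ‖y‖) (‖x‖⁻¹ • innerSL ℝ x) x := by
    have h := (hasStrictFDerivAt_norm_sq x).hasFDerivAt.sqrt (by positivity)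
    simp only [Real.sqrt_sq (norm_nonneg _)] at h
    convert h using 1
    ext v
    simp
    field_simp
  have h := ((hasDerivAt_pow n ‖x‖).inv (pow_ne_zero n hx')).comp_hasFDerivAt x hn
  refine h.congr_fderiv ?_
  rw [smul_smul]
  congr 1
  rcases n with _ | n
  · simp
  · rw [Nat.add_sub_cancel]
    field_simp
    ring

theorem contDiffAt_inv_norm_sub {z x : R3} (hx : x ≠ z) {n : WithTop ℕ∞} :
    ContDiffAt ℝ n (fun y : R3 => ‖y - z‖⁻¹) x :=
  ((contDiffAt_id.sub contDiffAt_const).norm ℝ (sub_ne_zero.2 hx)).inv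
    (norm_ne_zero_iff.2 (sub_ne_zero.2 hx))

/-- With `y = x - z` and `r = ‖y‖`, the Hessian is `-r⁻³ I + 3 r⁻⁵ y ⊗ y`, whose trace in dimension
three is `-3 r⁻³ + 3 r⁻³`. -/
theorem laplacian_inv_norm_sub {z x : R3} (hx : x ≠ z) :
    Δ (fun y : R3 => ‖y - z‖⁻¹) x = 0 := by
  obtain ⟨J, hJ⟩ : ∃ J : R3 →L[ℝ] R3 →L[ℝ] ℝ, ∀ y, J y = innerSL ℝ y :=
    ⟨innerSL ℝ, fun _ => rfl⟩
  have h1 (y : R3) (hy : y ≠ z) : HasFDerivAt (fun y : R3 => ‖y - z‖⁻¹)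
      (-(‖y - z‖ ^ 3)⁻¹ • J (y - z)) y := by
    have h := (hasFDerivAt_inv_norm_pow (sub_ne_zero.2 hy) 1).comp y
      ((hasFDerivAt_id y).sub_const z)
    rw [hJ]
    simp only [Function.comp_def, pow_one, id_eq] at h
    refine h.congr_fderiv ?_
    ext v
    simp
  have h2 : fderiv ℝ (fun y : R3 => ‖y - z‖⁻¹) =ᶠ[𝓝 x]
      fun y => -(‖y - z‖ ^ 3)⁻¹ • J (y - z) := by
    filter_upwards [isOpen_ne.mem_nhds hx] with y hy using (h1 y hy).fderiv
  have hx0 : ‖x - z‖ ≠ 0 := norm_ne_zero_iff.2 (sub_ne_zero.2 hx)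
  have h3 : HasFDerivAt (fun y : R3 => -(‖y - z‖ ^ 3)⁻¹ • J (y - z))
      (-(‖x - z‖ ^ 3)⁻¹ • J + ((3 * (‖x - z‖ ^ 5)⁻¹) • J (x - z)).smulRight (J (x - z))) x := by
    have h := (((hasFDerivAt_inv_norm_pow (sub_ne_zero.2 hx) 3).comp x
      ((hasFDerivAt_id x).sub_const z)).neg).smul
      (J.hasFDerivAt.comp x ((hasFDerivAt_id x).sub_const z))
    refine h.congr_fderiv ?_
    ext v w
    simp [hJ, ContinuousLinearMap.comp_id]
  rw [laplacian_eq_sum_fderiv_fderiv (EuclideanSpace.basisFun (Fin 3) ℝ), h2.fderiv_eq, h3.fderiv]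
  have h5 : ‖x - z‖ ^ 2 = (x - z) 0 ^ 2 + (x - z) 1 ^ 2 + (x - z) 2 ^ 2 := by
    rw [EuclideanSpace.real_norm_sq_eq, Fin.sum_univ_three]
  simp [Fin.sum_univ_three, hJ, EuclideanSpace.inner_single_right]
  simp at h5
  field_simp
  linear_combination -3 * h5

end Newtonian

/-! ### Weighted mean value property -/

section MeanValue

variable {E : Type*} [NormedAddCommGroup E]

/-- A nonnegative radial weight supported in the unit ball. -/
noncomputable def radialWeight (y : E) : ℝ := max 0 (1 - ‖y‖ ^ 2)

theorem radialWeight_nonneg (y : E) : 0 ≤ radialWeight y := le_max_left _ _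

theorem radialWeight_le_one (y : E) : radialWeight y ≤ 1 :=
  max_le zero_le_one (by nlinarith [sq_nonneg ‖y‖])

theorem continuous_radialWeight : Continuous (radialWeight : E → ℝ) := by
  unfold radialWeight
  fun_prop

theorem radialWeight_eq_zero {y : E} (hy : 1 ≤ ‖y‖) : radialWeight y = 0 :=
  max_eq_left (by nlinarith)

theorem radialWeight_zero : radialWeight (0 : E) = 1 := by simp [radialWeight]

variable [InnerProductSpace ℝ E]

/-- `radialWeight y • y` is the gradient of `-radialWeight ^ 2 / 4`. -/
theorem hasFDerivAt_radialWeight_sq (y : E) :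
    HasFDerivAt (fun y : E => -(1 / 4) * radialWeight y ^ 2) (radialWeight y • innerSL ℝ y) y := by
  have h1 (t : ℝ) : HasDerivAt (fun t : ℝ => max 0 t ^ 2) (2 * max 0 t) t := by
    rcases lt_trichotomy t 0 with ht | rfl | ht
    · have : (fun t : ℝ => max 0 t ^ 2) =ᶠ[𝓝 t] fun _ => 0 := by
        filter_upwards [gt_mem_nhds ht] with u hu
        simp [max_eq_left hu.le]
      rw [max_eq_left ht.le, mul_zero]
      exact (hasDerivAt_const t (0 : ℝ)).congr_of_eventuallyEq this
    -- The squared positive part is `O(t²)` at the kink, so it is differentiable there.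
    · rw [max_self, mul_zero, hasDerivAt_iff_isLittleO]
      simp only [sub_zero, smul_zero, max_self, ne_eq, OfNat.ofNat_ne_zero, not_false_eq_true,
        zero_pow]
      refine IsBigO.trans_isLittleO (g := fun t : ℝ => t ^ 2) ?_ ?_
      · refine IsBigO.of_bound 1 (Eventually.of_forall fun t => ?_)
        rw [one_mul, norm_pow, norm_pow, Real.norm_of_nonneg (le_max_left 0 t)]
        exact pow_le_pow_left₀ (le_max_left 0 t) (max_le (abs_nonneg _) (le_abs_self _)) 2
      · simpa using (isLittleO_pow_pow (𝕜 := ℝ) (m := 1) (n := 2) (by norm_num))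
    · have : (fun t : ℝ => max 0 t ^ 2) =ᶠ[𝓝 t] fun t => t ^ 2 := by
        filter_upwards [lt_mem_nhds ht] with u hu
        rw [max_eq_right hu.le]
      rw [max_eq_right ht.le]
      simpa using (hasDerivAt_pow 2 t).congr_of_eventuallyEq this
  have h2 := ((h1 (1 - ‖y‖ ^ 2)).comp_hasFDerivAt y
    ((hasStrictFDerivAt_norm_sq y).hasFDerivAt.const_sub 1)).const_mul (-(1 / 4) : ℝ)
  refine h2.congr_fderiv ?_
  ext v
  simp only [radialWeight, smul_apply, neg_apply, smul_eq_mul, nsmul_eq_mul]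
  ring

variable [FiniteDimensional ℝ E]

theorem hasCompactSupport_radialWeight : HasCompactSupport (radialWeight : E → ℝ) := by
  refine HasCompactSupport.intro (isCompact_closedBall (0 : E) 1) fun y hy => ?_
  exact radialWeight_eq_zero (by simpa using (not_le.1 (mt mem_closedBall_zero_iff.2 hy)).le)

variable [MeasurableSpace E] [BorelSpace E]
  {F : Type*} [NormedAddCommGroup F] [NormedSpace ℝ F]

theorem integral_radialWeight_pos : 0 < ∫ y : E, radialWeight y :=
  continuous_radialWeight.integral_pos_of_hasCompactSupport_nonneg_nonzero
    hasCompactSupport_radialWeight radialWeight_nonneg (x := 0) (by simp [radialWeight_zero])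

theorem integrable_radialWeight_smul {f : E → F} (hf : Continuous f) :
    Integrable fun y => radialWeight y • f y :=
  (continuous_radialWeight.smul hf).integrable_of_hasCompactSupport
    hasCompactSupport_radialWeight.smul_right

/-- The radial derivatives of a harmonic function have mean zero. -/
theorem integral_radialWeight_smul_fderiv_eq_zero {u : E → F} (hu : ContDiff ℝ 2 u) {x : E}
    (hΔ : ∀ y ∈ Metric.ball x 1, Δ u y = 0) {r : ℝ} (hr : |r| ≤ 1) :
    ∫ y, radialWeight y • fderiv ℝ u (x + r • y) y = 0 := by
  set b := stdOrthonormalBasis ℝ E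
  have hu1 : ContDiff ℝ 1 (fderiv ℝ u) := hu.fderiv_right (by norm_num)
  have hD : Continuous fun y : E => fderiv ℝ u (x + r • y) := hu1.continuous.comp (by fun_prop)
  have hDD : Continuous fun y : E => fderiv ℝ (fderiv ℝ u) (x + r • y) :=
    (hu1.continuous_fderiv one_ne_zero).comp (by fun_prop)
  -- Integration by parts against the primitive `-radialWeight ^ 2 / 4`; the factor `r` is from the
  -- chain rule. Summing over `i` produces the Laplacian of `u`.
  have hparts (i) : ∫ y, (radialWeight y * inner ℝ y (b i)) • fderiv ℝ u (x + r • y) (b i) =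
      -∫ y, r • (-(1 / 4) * radialWeight y ^ 2) •
        fderiv ℝ (fderiv ℝ u) (x + r • y) (b i) (b i) := by
    have hg (y : E) : HasFDerivAt (fun y => fderiv ℝ u (x + r • y) (b i))
        ((ContinuousLinearMap.apply ℝ F (b i)).comp
          ((fderiv ℝ (fderiv ℝ u) (x + r • y)).comp (r • ContinuousLinearMap.id ℝ E))) y := by
      have h1 : HasFDerivAt (fun y : E => x + r • y) (r • ContinuousLinearMap.id ℝ E) y :=
        ((hasFDerivAt_id y).const_smul r).const_add x
      have h2 := ((hu1.differentiable one_ne_zero (x + r • y)).hasFDerivAt.comp y h1)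
      exact (ContinuousLinearMap.apply ℝ F (b i)).hasFDerivAt.comp y h2
    have hW := fun y : E => hasFDerivAt_radialWeight_sq y
    have key := integral_bilinear_hasFDerivAt_right_eq_neg_left_of_integrable (μ := volume)
      (v := b i) (B := (ContinuousLinearMap.lsmul ℝ ℝ (E := F)))
      (f := fun y : E => -(1 / 4) * radialWeight y ^ 2)
      (f' := fun y => radialWeight y • innerSL ℝ y)
      (g := fun y => fderiv ℝ u (x + r • y) (b i)) ?_ ?_ ?_ (fun y _ => hW y) (fun y _ => hg y)
    · simp only [ContinuousLinearMap.lsmul_apply, smul_apply, innerSL_apply_apply, smul_eq_mul,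
        ContinuousLinearMap.comp_apply, ContinuousLinearMap.apply_apply, map_smul,
        ContinuousLinearMap.id_apply] at key
      rw [key, neg_neg]
    · simp only [ContinuousLinearMap.lsmul_apply, smul_apply, innerSL_apply_apply, smul_eq_mul,
        mul_smul]
      exact integrable_radialWeight_smul (by fun_prop)
    · simp only [ContinuousLinearMap.lsmul_apply, smul_apply,
        ContinuousLinearMap.comp_apply, ContinuousLinearMap.apply_apply, map_smul,
        ContinuousLinearMap.id_apply]
      have := integrable_radialWeight_smul (E := E) (f := fun y => (-(1 / 4) * radialWeight y) •
        (r • fderiv ℝ (fderiv ℝ u) (x + r • y) (b i) (b i)))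
        (by have := continuous_radialWeight (E := E); fun_prop)
      refine this.congr (Eventually.of_forall fun y => ?_)
      simp only [smul_smul]
      ring_nf
    · simp only [ContinuousLinearMap.lsmul_apply]
      have := integrable_radialWeight_smul (E := E) (f := fun y => (-(1 / 4) * radialWeight y) •
        fderiv ℝ u (x + r • y) (b i)) (by have := continuous_radialWeight (E := E); fun_prop)
      refine this.congr (Eventually.of_forall fun y => ?_)
      simp only [smul_smul]
      ring_nf
  have hL (L : E →L[ℝ] F) (y : E) : L y = ∑ i, inner ℝ y (b i) • L (b i) := by
    conv_lhs => rw [← b.sum_repr' y]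
    simp only [map_sum, map_smul, real_inner_comm]
  have hsum (y : E) : radialWeight y • fderiv ℝ u (x + r • y) y =
      ∑ i, (radialWeight y * inner ℝ y (b i)) • fderiv ℝ u (x + r • y) (b i) := by
    rw [hL (fderiv ℝ u (x + r • y)) y]
    simp only [Finset.smul_sum, mul_smul]
  simp_rw [hsum]
  rw [integral_finsetSum]
  · simp_rw [hparts, Finset.sum_neg_distrib]
    rw [← integral_finsetSum]
    · rw [neg_eq_zero]
      refine integral_eq_zero_of_ae (Eventually.of_forall fun y => ?_)
      simp only [← Finset.smul_sum, ← laplacian_eq_sum_fderiv_fderiv, Pi.zero_apply]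
      rcases le_or_gt 1 ‖y‖ with hy | hy
      · simp [radialWeight_eq_zero hy]
      · rw [hΔ, smul_zero, smul_zero]
        rw [mem_ball_iff_norm, add_sub_cancel_left, norm_smul, Real.norm_eq_abs]
        nlinarith [norm_nonneg y, abs_nonneg r]
    · intro i _
      have := integrable_radialWeight_smul (E := E) (f := fun y => (-(1 / 4) * radialWeight y) •
        (r • fderiv ℝ (fderiv ℝ u) (x + r • y) (b i) (b i)))
        (by have := continuous_radialWeight (E := E); fun_prop)
      refine this.congr (Eventually.of_forall fun y => ?_)
      simp only [smul_smul]
      ring_nf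
  · intro i _
    simp only [mul_smul]
    exact integrable_radialWeight_smul (by fun_prop)

/-- **Weighted mean value property** of harmonic functions. -/
theorem integral_radialWeight_smul_of_contDiff [CompleteSpace F] {u : E → F}
    (hu : ContDiff ℝ 2 u) {x : E} (hΔ : ∀ y ∈ Metric.ball x 1, Δ u y = 0) :
    ∫ y, radialWeight y • u (x + y) = (∫ y : E, radialWeight y) • u x := by
  -- Dilation connects the weighted mean `g 1` to the value at the centre, `g 0`; `g' = 0` on `[0,
  -- 1)`.
  set g : ℝ → F := fun r => ∫ y, radialWeight y • u (x + r • y) with hg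
  have hcu := hu.continuous
  have hcD := hu.continuous_fderiv two_ne_zero
  have hderiv (r : ℝ) : HasDerivAt g (∫ y, radialWeight y • fderiv ℝ u (x + r • y) y) r := by
    have hK : IsCompact (Metric.closedBall r 1 ×ˢ Metric.closedBall (0 : E) 1) :=
      (isCompact_closedBall r 1).prod (isCompact_closedBall 0 1)
    have hc : Continuous fun p : ℝ × E => fderiv ℝ u (x + p.1 • p.2) p.2 := by fun_prop
    obtain ⟨C, hC⟩ := hK.exists_bound_of_continuousOn hc.continuousOn
    refine (hasDerivAt_integral_of_dominated_loc_of_deriv_le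
      (F := fun r y => radialWeight y • u (x + r • y))
      (F' := fun r y => radialWeight y • fderiv ℝ u (x + r • y) y)
      (bound := fun y => radialWeight y • C) (Metric.closedBall_mem_nhds r one_pos)
      ?_ ?_ ?_ ?_ ?_ ?_).2
    · exact Eventually.of_forall fun r =>
        (integrable_radialWeight_smul (by fun_prop)).aestronglyMeasurable
    · exact integrable_radialWeight_smul (by fun_prop)
    · exact (integrable_radialWeight_smul (by fun_prop)).aestronglyMeasurable
    · refine Eventually.of_forall fun y ρ hρ => ?_
      rw [norm_smul, Real.norm_of_nonneg (radialWeight_nonneg y), smul_eq_mul]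
      rcases le_or_gt 1 ‖y‖ with hy | hy
      · simp [radialWeight_eq_zero hy]
      · exact mul_le_mul_of_nonneg_left (hC (ρ, y) ⟨hρ, by simpa using hy.le⟩)
          (radialWeight_nonneg y)
    · exact integrable_radialWeight_smul continuous_const
    · refine Eventually.of_forall fun y ρ _ => ?_
      have h1 : HasDerivAt (fun ρ : ℝ => x + ρ • y) y ρ := by
        simpa using ((hasDerivAt_id ρ).smul_const y).const_add x
      exact ((hu.differentiable two_ne_zero _).hasFDerivAt.comp_hasDerivAt ρ h1).const_smul _
  have hconst : g 1 = g 0 := by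
    refine constant_of_has_deriv_right_zero (a := 0) (b := 1)
      (fun r _ => (hderiv r).continuousAt.continuousWithinAt) (fun r hr => ?_) 1 (by simp)
    have := (hderiv r).hasDerivWithinAt (s := Set.Ici r)
    rwa [integral_radialWeight_smul_fderiv_eq_zero hu hΔ
      (abs_le.2 ⟨by linarith [hr.1], hr.2.le⟩)] at this
  simpa [hg, integral_smul_const] using hconst

end MeanValue

open InnerProductSpace

/-! ### Decay of square-integrable harmonic functions -/

section Decay

variable {E : Type*} [NormedAddCommGroup E] [InnerProductSpace ℝ E] [FiniteDimensional ℝ E]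
  [MeasurableSpace E] [BorelSpace E] {F : Type*} [NormedAddCommGroup F] [NormedSpace ℝ F]

/-- A cutoff equal to 1 on the unit ball and to 0 beyond radius 2 reduces this to a globally `C²`
function; radius 3 leaves room to check smoothness. -/
theorem integral_radialWeight_smul_of_harmonicOnNhd [CompleteSpace F] {u : E → F} {x : E}
    (hu : HarmonicOnNhd u (Metric.ball x 3)) :
    ∫ y, radialWeight y • u (x + y) = (∫ y : E, radialWeight y) • u x := by
  let χ : ContDiffBump x := ⟨1, 2, one_pos, one_lt_two⟩
  have hone {y : E} (hy : y ∈ Metric.ball x 1) : (fun y => χ y • u y) =ᶠ[𝓝 y] u := by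
    filter_upwards [χ.eventuallyEq_one_of_mem_ball hy] with w hw
    simp [hw]
  have hsmooth : ContDiff ℝ 2 fun y => χ y • u y := by
    rw [contDiff_iff_contDiffAt]
    intro y
    rcases lt_or_ge (dist y x) 3 with hy | hy
    · exact χ.contDiff.contDiffAt.smul (hu y hy).1
    · refine (contDiffAt_const (c := (0 : F))).congr_of_eventuallyEq ?_
      have : (Metric.closedBall x 2)ᶜ ∈ 𝓝 y :=
        Metric.isClosed_closedBall.isOpen_compl.mem_nhds (by simp; linarith)
      filter_upwards [this] with w hw
      rw [χ.zero_of_le_dist (by simpa using (not_le.1 (mt Metric.mem_closedBall.2 hw)).le),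
        zero_smul]
  have key := integral_radialWeight_smul_of_contDiff hsmooth (x := x) fun y hy => by
    rw [(laplacian_congr_nhds (hone hy)).self_of_nhds]
    exact (hu y (Metric.ball_subset_ball (by norm_num) hy)).2.self_of_nhds
  have hx1 : χ x • u x = u x := (hone (Metric.mem_ball_self one_pos)).self_of_nhds
  rw [hx1] at key
  rw [← key]
  refine integral_congr_ae (Eventually.of_forall fun y => ?_)
  rcases le_or_gt 1 ‖y‖ with hy | hy
  · simp [radialWeight_eq_zero hy]
  · have : x + y ∈ Metric.ball x 1 := by simpa using hy
    have hxy : χ (x + y) • u (x + y) = u (x + y) := (hone this).self_of_nhds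
    simp only [hxy]

/-- A square-integrable function which is harmonic near infinity vanishes at infinity. -/
theorem tendsto_cobounded_of_harmonicOnNhd_of_memLp [CompleteSpace F] {u : E → F} {K : Set E}
    (hK : Bornology.IsBounded K) (hu : HarmonicOnNhd u Kᶜ) (hL : MemLp u 2 volume) :
    Tendsto u (Bornology.cobounded E) (𝓝 0) := by
  have hsq : Integrable fun y => ‖u y‖ ^ 2 := (memLp_two_iff_integrable_sq_norm hL.1).1 hL
  set c : ℝ := ∫ y : E, radialWeight y with hc
  have hcpos : 0 < c := integral_radialWeight_pos
  set h : E → ℝ := fun x => ∫ y, radialWeight y * ‖u (x + y)‖ ^ 2 with hh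
  have hsqt (x : E) : Integrable fun y => ‖u (x + y)‖ ^ 2 := hsq.comp_add_left x
  have hint (x : E) : Integrable fun y => radialWeight y * ‖u (x + y)‖ ^ 2 := by
    refine (hsqt x).bdd_mul (c := 1) continuous_radialWeight.aestronglyMeasurable
      (Eventually.of_forall fun y => ?_)
    rw [Real.norm_of_nonneg (radialWeight_nonneg y)]
    exact radialWeight_le_one y
  have hw : Integrable (radialWeight : E → ℝ) :=
    continuous_radialWeight.integrable_of_hasCompactSupport hasCompactSupport_radialWeight
  -- The weight centred at `x` leaves every fixed point as `x` goes to infinity; `‖u‖ ^ 2`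
  -- dominates.
  have hlim : Tendsto h (Bornology.cobounded E) (𝓝 0) := by
    have hshift (x : E) : h x = ∫ y, radialWeight (y - x) * ‖u y‖ ^ 2 := by
      rw [hh, ← integral_add_left_eq_self (μ := (volume : Measure E)) _ x]
      simp
    have : (Bornology.cobounded E).IsCountablyGenerated := by
      rw [← comap_norm_atTop]
      infer_instance
    rw [show h = fun x => ∫ y, radialWeight (y - x) * ‖u y‖ ^ 2 from funext hshift]
    rw [← integral_zero E ℝ (μ := volume)]
    refine tendsto_integral_filter_of_dominated_convergence (fun y => ‖u y‖ ^ 2) ?_ ?_ hsq ?_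
    · refine Eventually.of_forall fun x => ?_
      have : Continuous fun y => radialWeight (y - x) :=
        continuous_radialWeight.comp (by fun_prop)
      exact this.aestronglyMeasurable.mul hsq.aestronglyMeasurable
    · refine Eventually.of_forall fun x => Eventually.of_forall fun y => ?_
      rw [norm_mul, Real.norm_of_nonneg (radialWeight_nonneg _), norm_pow, norm_norm]
      exact mul_le_of_le_one_left (by positivity) (radialWeight_le_one _)
    · refine Eventually.of_forall fun y => ?_
      refine tendsto_const_nhds.congr' ?_
      filter_upwards [tendsto_norm_cobounded_atTop.eventually_ge_atTop (‖y‖ + 1)] with x hx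
      rw [radialWeight_eq_zero, zero_mul]
      have := norm_sub_norm_le x y
      rw [norm_sub_rev] at this
      linarith
  obtain ⟨R, hR⟩ := hK.subset_closedBall 0
  rw [Metric.tendsto_nhds]
  intro η hη
  set ε := η / 4 with hε
  have hεpos : 0 < ε := by positivity
  -- The first bound keeps the ball of radius 3 about `x` away from `K`. The second, with `t ≤ ε +
  -- t² / (4ε)` under the integral, yields `‖u x‖ < 2ε = η / 2`.
  filter_upwards [tendsto_norm_cobounded_atTop.eventually_ge_atTop (R + 3 + 1),
    hlim.eventually (gt_mem_nhds (show 0 < 4 * ε * (ε * c) by positivity))] with x hx hhx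
  have hball : HarmonicOnNhd u (Metric.ball x 3) := by
    refine hu.mono fun y hy hyK => ?_
    have h1 := hR hyK
    rw [mem_closedBall_zero_iff] at h1
    rw [mem_ball_iff_norm, norm_sub_rev] at hy
    linarith [norm_sub_norm_le x y]
  have hmv := integral_radialWeight_smul_of_harmonicOnNhd hball
  have hbound : ‖∫ y, radialWeight y • u (x + y)‖ ≤
      ∫ y, (ε * radialWeight y + (4 * ε)⁻¹ * (radialWeight y * ‖u (x + y)‖ ^ 2)) := by
    refine norm_integral_le_of_norm_le ((hw.const_mul ε).add ((hint x).const_mul _))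
      (Eventually.of_forall fun y => ?_)
    rw [norm_smul, Real.norm_of_nonneg (radialWeight_nonneg y)]
    have h1 : ‖u (x + y)‖ ≤ ε + (4 * ε)⁻¹ * ‖u (x + y)‖ ^ 2 := by
      have : ε + (4 * ε)⁻¹ * ‖u (x + y)‖ ^ 2 - ‖u (x + y)‖ =
          (4 * ε)⁻¹ * (‖u (x + y)‖ - 2 * ε) ^ 2 := by field_simp; ring
      nlinarith [show 0 ≤ (4 * ε)⁻¹ * (‖u (x + y)‖ - 2 * ε) ^ 2 by positivity]
    calc radialWeight y * ‖u (x + y)‖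
        ≤ radialWeight y * (ε + (4 * ε)⁻¹ * ‖u (x + y)‖ ^ 2) :=
          mul_le_mul_of_nonneg_left h1 (radialWeight_nonneg y)
      _ = _ := by ring
  rw [integral_add (hw.const_mul ε) ((hint x).const_mul _), integral_const_mul,
    integral_const_mul, hmv, norm_smul, Real.norm_of_nonneg hcpos.le] at hbound
  have h2 : (4 * ε)⁻¹ * h x < ε * c := by
    rw [inv_mul_lt_iff₀ (by positivity)]
    exact hhx
  have h3 : c * ‖u x‖ < c * (2 * ε) := by
    calc c * ‖u x‖ ≤ ε * c + (4 * ε)⁻¹ * h x := hbound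
      _ < c * (2 * ε) := by linarith
  rw [dist_zero_right]
  have := lt_of_mul_lt_mul_left h3 hcpos.le
  linarith

end Decay

/-! ### Maximum principle with punctures -/

section MaximumPrinciple

theorem harmonicAt_inv_norm_sub {z x : R3} (hx : x ≠ z) :
    HarmonicAt (fun y : R3 => ‖y - z‖⁻¹) x := by
  refine ⟨contDiffAt_inv_norm_sub hx, ?_⟩
  filter_upwards [isOpen_ne.mem_nhds hx] with y hy using laplacian_inv_norm_sub hy

theorem harmonicAt_finsetSum {E F ι : Type*} [NormedAddCommGroup E] [InnerProductSpace ℝ E]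
    [FiniteDimensional ℝ E] [NormedAddCommGroup F] [NormedSpace ℝ F] {f : ι → E → F} {x : E}
    (s : Finset ι) (hf : ∀ i ∈ s, HarmonicAt (f i) x) :
    HarmonicAt (fun y => ∑ i ∈ s, f i y) x := by
  classical
  induction s using Finset.induction_on with
  | empty => simp
  | insert i s hi ih =>
    simp only [Finset.sum_insert hi]
    exact (hf i (Finset.mem_insert_self i s)).add
      (ih fun j hj => hf j (Finset.mem_insert_of_mem hj))

/-- Maximum principle on a punctured space: isolated points near which a harmonic function is
bounded above may be ignored. -/
theorem nonpos_of_harmonicOnNhd_punctured {n : ℕ} {z : Fin n → R3} {u : R3 → ℝ}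
    (hu : HarmonicOnNhd u (Set.range z)ᶜ)
    (hb : ∀ j, ∃ M, ∀ᶠ x in 𝓝[≠] z j, u x ≤ M)
    (hinf : Tendsto u (Bornology.cobounded R3) (𝓝 0)) {x₀ : R3} (hx₀ : x₀ ∈ (Set.range z)ᶜ) :
    u x₀ ≤ 0 := by
  by_contra! hpos
  -- `N` is a barrier, infinite at the punctures; `ε` is small enough that `c = u x₀ - ε * N x₀`
  -- stays positive.
  set N : R3 → ℝ := fun x => ∑ j, ‖x - z j‖⁻¹ with hN
  have hNnonneg (x) : 0 ≤ N x := Finset.sum_nonneg fun j _ => by positivity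
  set ε := u x₀ / (2 * (N x₀ + 1)) with hε
  have hεpos : 0 < ε := div_pos hpos (by linarith [hNnonneg x₀])
  set c := u x₀ - ε * N x₀ with hc
  have hcpos : 0 < c := by
    have : ε * (2 * (N x₀ + 1)) = u x₀ := div_mul_cancel₀ _ (by linarith [hNnonneg x₀])
    nlinarith [hNnonneg x₀]
  obtain ⟨r, hr⟩ : ∃ r, ∀ x : R3, r ≤ ‖x‖ → u x < c / 2 := by
    simpa using (hasBasis_cobounded_norm.eventually_iff).1
      (hinf.eventually (gt_mem_nhds (half_pos hcpos)))
  set R := max r (‖x₀‖ + 1) with hRdef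
  have hRx : ‖x₀‖ < R := lt_of_lt_of_le (lt_add_one _) (le_max_right _ _)
  have hRpos : 0 < R := lt_of_le_of_lt (norm_nonneg _) hRx
  set δ := c / (4 * R ^ 2) with hδ
  have hδpos : 0 < δ := by positivity
  have hδR : δ * R ^ 2 = c / 4 := by rw [hδ]; field_simp
  -- The quadratic term makes `Δ w > 0`, and `δ * R ^ 2 = c / 4` keeps `w < c` on the sphere of
  -- radius `R`. Near the punctures the barrier gives `w < c`, so a maximum with value at least `c`
  -- would be interior.
  set w : R3 → ℝ := fun x => u x - ε * N x + δ * ‖x‖ ^ 2 with hw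
  have hharm : ∀ x ∈ (Set.range z)ᶜ, HarmonicAt (fun x => u x - ε * N x) x := fun x hx =>
    (hu x hx).sub ((harmonicAt_finsetSum Finset.univ fun j _ =>
      harmonicAt_inv_norm_sub fun h => hx ⟨j, h.symm⟩).const_smul (c := ε))
  have hquad (x : R3) : ContDiffAt ℝ 2 (fun x : R3 => δ * ‖x‖ ^ 2) x :=
    contDiffAt_const.mul (contDiff_norm_sq ℝ).contDiffAt
  have hwc : ∀ x ∈ (Set.range z)ᶜ, ContDiffAt ℝ 2 w x := fun x hx => (hharm x hx).1.add (hquad x)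
  have hwΔ : ∀ x ∈ (Set.range z)ᶜ, 0 < Δ w x := fun x hx => by
    have h1 : Δ w x = Δ (fun x => u x - ε * N x) x + Δ (fun x : R3 => δ * ‖x‖ ^ 2) x :=
      (hharm x hx).1.laplacian_add (hquad x)
    have h2 : Δ (fun x : R3 => δ * ‖x‖ ^ 2) x = δ * Δ (fun x : R3 => ‖x‖ ^ 2) x :=
      laplacian_smul δ (contDiff_norm_sq ℝ).contDiffAt
    rw [h1, h2, laplacian_norm_sq, (hharm x hx).2.self_of_nhds]
    simp
    positivity
  have hwx₀ : c ≤ w x₀ := by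
    have : 0 ≤ δ * ‖x₀‖ ^ 2 := by positivity
    simp only [hw]
    linarith
  have hnear (j) : ∃ U : Set R3, IsOpen U ∧ z j ∈ U ∧ ∀ x ∈ U, x ≠ z j → w x < c := by
    obtain ⟨M, hM⟩ := hb j
    have hto : Tendsto (fun x => ‖x - z j‖⁻¹) (𝓝[≠] z j) atTop := by
      refine Tendsto.inv_tendsto_nhdsGT_zero ?_
      refine tendsto_nhdsWithin_iff.2 ⟨?_, ?_⟩
      · have : Continuous fun x : R3 => ‖x - z j‖ := by fun_prop
        simpa using (this.tendsto (z j)).mono_left nhdsWithin_le_nhds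
      · filter_upwards [self_mem_nhdsWithin] with x hx
        exact norm_pos_iff.2 (sub_ne_zero.2 hx)
    have hnorm : ∀ᶠ x in 𝓝[≠] z j, ‖x‖ < ‖z j‖ + 1 :=
      nhdsWithin_le_nhds (continuous_norm.continuousAt.eventually (gt_mem_nhds (lt_add_one _)))
    have hev : ∀ᶠ x in 𝓝[≠] z j, w x < c := by
      filter_upwards [hM, hnorm,
        hto.eventually_gt_atTop ((M + δ * (‖z j‖ + 1) ^ 2) / ε)] with x h1 h2 h3
      rw [div_lt_iff₀ hεpos] at h3
      have h4 : ‖x - z j‖⁻¹ ≤ N x :=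
        Finset.single_le_sum (f := fun j => ‖x - z j‖⁻¹) (fun j _ => by positivity)
          (Finset.mem_univ j)
      have h5 : δ * ‖x‖ ^ 2 ≤ δ * (‖z j‖ + 1) ^ 2 := by gcongr
      simp only [hw]
      nlinarith [mul_le_mul_of_nonneg_left h4 hεpos.le]
    obtain ⟨U, hUsub, hUo, hU⟩ := eventually_nhds_iff.1 (eventually_nhdsWithin_iff.1 hev)
    exact ⟨U, hUo, hU, fun x hx hne => hUsub x hx hne⟩
  choose U hUo hzU hU using hnear
  set K := Metric.closedBall (0 : R3) R ∩ (⋃ j, U j)ᶜ with hKdef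
  have hKc : IsCompact K :=
    (isCompact_closedBall _ _).inter_right (isOpen_iUnion hUo).isClosed_compl
  have hKS : K ⊆ (Set.range z)ᶜ := by
    rintro _ hx ⟨j, rfl⟩
    exact hx.2 (Set.mem_iUnion.2 ⟨j, hzU j⟩)
  have hx₀K : x₀ ∈ K := by
    refine ⟨by simpa using hRx.le, fun h => ?_⟩
    obtain ⟨j, hj⟩ := Set.mem_iUnion.1 h
    exact absurd (hU j x₀ hj fun h => hx₀ ⟨j, h.symm⟩) (not_lt.2 hwx₀)
  obtain ⟨p, hpK, hpmax⟩ := hKc.exists_isMaxOn ⟨x₀, hx₀K⟩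
    fun x hx => (hwc x (hKS hx)).continuousAt.continuousWithinAt
  have hwp : c ≤ w p := hwx₀.trans (hpmax hx₀K)
  have hpR : ‖p‖ < R := by
    refine lt_of_le_of_ne (by simpa using hpK.1) fun h => ?_
    have h1 := hr p (h ▸ le_max_left _ _)
    have h2 : 0 ≤ ε * N p := mul_nonneg hεpos.le (hNnonneg p)
    simp only [hw, h] at hwp
    linarith
  have hlocal : IsLocalMax w p := by
    filter_upwards [(isOpen_compl_range z).mem_nhds (hKS hpK),
      continuous_norm.continuousAt.eventually (gt_mem_nhds hpR)] with x hxS hxR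
    -- `p` may lie on the boundary of some `U j`, but inside `U j` the values are below `c ≤ w p`.
    by_cases hxU : x ∈ ⋃ j, U j
    · obtain ⟨j, hj⟩ := Set.mem_iUnion.1 hxU
      exact (hU j x hj fun h => hxS ⟨j, h.symm⟩).le.trans hwp
    · exact hpmax ⟨by simpa using hxR.le, hxU⟩
  exact absurd (laplacian_nonpos_of_isLocalMax (hwc p (hKS hpK)) hlocal)
    (not_le.2 (hwΔ p (hKS hpK)))

/-- A complex-valued harmonic function on a punctured space which is bounded near the punctures
and vanishes at infinity is zero. -/
theorem eq_zero_of_harmonicOnNhd_punctured {n : ℕ} {z : Fin n → R3} {u : R3 → ℂ}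
    (hu : HarmonicOnNhd u (Set.range z)ᶜ)
    (hb : ∀ j, u =O[𝓝[≠] z j] fun _ => (1 : ℝ))
    (hinf : Tendsto u (Bornology.cobounded R3) (𝓝 0)) {x : R3} (hx : x ∈ (Set.range z)ᶜ) :
    u x = 0 := by
  have key (l : ℂ →L[ℝ] ℝ) : l (u x) ≤ 0 := by
    refine nonpos_of_harmonicOnNhd_punctured (u := l ∘ u) (hu.comp_CLM l) (fun j => ?_) ?_ hx
    · obtain ⟨M, hM⟩ := ((l.isBigO_comp u _).trans (hb j)).bound
      refine ⟨M, hM.mono fun y hy => (le_abs_self _).trans (by simpa using hy)⟩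
    · simpa using (l.continuous.tendsto 0).comp hinf
  have h1 := key Complex.reCLM
  have h2 := key (-Complex.reCLM)
  have h3 := key Complex.imCLM
  have h4 := key (-Complex.imCLM)
  simp only [neg_apply, Complex.reCLM_apply, Complex.imCLM_apply] at h1 h2 h3 h4
  exact Complex.ext (by simp; linarith) (by simp; linarith)

end MaximumPrinciple

/-! ### Square integrability of differences of Coulomb potentials -/

section SquareIntegrability

/-- The function `x ↦ |x|⁻²`, cut off outside a ball, is integrable in dimension three. -/
theorem integrable_indicator_inv_norm_sq (ρ : ℝ) :
    Integrable fun x : R3 => (Set.Iic ρ).indicator (fun r : ℝ => (r ^ 2)⁻¹) ‖x‖ := by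
  -- In polar coordinates the Jacobian `r²` cancels the singularity.
  rw [integrable_fun_norm_addHaar]
  have h : IntegrableOn (fun _ : ℝ => (1 : ℝ)) (Set.Ioc 0 ρ) := by simp
  have h2 : IntegrableOn ((Set.Iic ρ).indicator fun _ : ℝ => (1 : ℝ)) (Set.Ioi 0) := by
    rw [IntegrableOn, integrable_indicator_iff measurableSet_Iic, IntegrableOn,
      Measure.restrict_restrict measurableSet_Iic, Set.Iic_inter_Ioi]
    exact h
  refine h2.congr_fun (fun r hr => ?_) measurableSet_Ioi
  have hr0 : r ≠ 0 := ne_of_gt hr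
  by_cases hρ : r ∈ Set.Iic ρ <;> simp [hρ, hr0]

/-- One Coulomb potential is not square integrable at infinity; subtracting another improves the
decay to `|x|⁻²`. -/
theorem memLp_inv_norm_sub_sub (a : R3) :
    MemLp (fun x : R3 => ‖x - a‖⁻¹ - ‖x‖⁻¹) 2 volume := by
  have hmeas : Measurable fun x : R3 => ‖x - a‖⁻¹ - ‖x‖⁻¹ := by fun_prop
  rw [memLp_two_iff_integrable_sq hmeas.aestronglyMeasurable]
  -- Beyond `R`, both `‖x‖` and `‖x - a‖` are at least `(1 + ‖x‖) / 4`. Within `R`, both `x` and `x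
  -- - a` lie in the cutoff ball of radius `R + ‖a‖`.
  set R := 2 * ‖a‖ + 1 with hR
  set G : R3 → ℝ := fun x => (Set.Iic (R + ‖a‖)).indicator (fun r : ℝ => (r ^ 2)⁻¹) ‖x‖ with hG
  have hGint : Integrable G := integrable_indicator_inv_norm_sq _
  have hGnn (x) : 0 ≤ G x := Set.indicator_nonneg (fun r _ => by positivity) _
  have hGmem {x : R3} (hx : ‖x‖ ≤ R + ‖a‖) : G x = (‖x‖⁻¹) ^ 2 := by
    have : ‖x‖ ∈ Set.Iic (R + ‖a‖) := hx
    simp only [hG, Set.indicator_of_mem this, inv_pow]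
  have hdec : Integrable fun x : R3 => (1 + ‖x‖) ^ (-4 : ℝ) :=
    integrable_one_add_norm (by simp; norm_num)
  refine (((hGint.comp_sub_right a).const_mul 2).add ((hGint.const_mul 2).add
    (hdec.const_mul (256 * ‖a‖ ^ 2)))).mono' (by fun_prop) (Eventually.of_forall fun x => ?_)
  have hna := norm_nonneg a
  have hpow : (1 + ‖x‖) ^ (-4 : ℝ) = ((1 + ‖x‖) ^ 4)⁻¹ := by
    rw [Real.rpow_neg (by positivity)]
    norm_cast
  simp only [Pi.add_apply, hpow]
  rw [Real.norm_of_nonneg (sq_nonneg _)]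
  have hdnn : 0 ≤ 256 * ‖a‖ ^ 2 * ((1 + ‖x‖) ^ 4)⁻¹ := by positivity
  rcases le_or_gt ‖x‖ R with hx | hx
  · rw [hGmem (x := x - a) (by linarith [norm_sub_le x a]), hGmem (x := x) (by linarith)]
    nlinarith [sq_nonneg (‖x - a‖⁻¹ + ‖x‖⁻¹)]
  · have h1 : (1 + ‖x‖) / 4 ≤ ‖x - a‖ := by linarith [norm_sub_norm_le x a]
    have h2 : (1 + ‖x‖) / 4 ≤ ‖x‖ := by linarith
    have hx0 : 0 < ‖x‖ := by linarith
    have hxa : 0 < ‖x - a‖ := by linarith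
    have h3 : |‖x - a‖⁻¹ - ‖x‖⁻¹| ≤ 16 * ‖a‖ * ((1 + ‖x‖) ^ 2)⁻¹ := by
      rw [inv_sub_inv hxa.ne' hx0.ne', abs_div, abs_of_pos (mul_pos hxa hx0),
        div_le_iff₀ (mul_pos hxa hx0)]
      have h4 : |‖x‖ - ‖x - a‖| ≤ ‖a‖ := by simpa using abs_norm_sub_norm_le x (x - a)
      have h5 : ((1 + ‖x‖) / 4) * ((1 + ‖x‖) / 4) ≤ ‖x - a‖ * ‖x‖ :=
        mul_le_mul h1 h2 (by positivity) hxa.le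
      calc |‖x‖ - ‖x - a‖| ≤ ‖a‖ := h4
        _ = 16 * ‖a‖ * ((1 + ‖x‖) ^ 2)⁻¹ * (((1 + ‖x‖) / 4) * ((1 + ‖x‖) / 4)) := by
          field_simp; norm_num
        _ ≤ _ := by gcongr
    have h6 : (‖x - a‖⁻¹ - ‖x‖⁻¹) ^ 2 ≤ (16 * ‖a‖ * ((1 + ‖x‖) ^ 2)⁻¹) ^ 2 :=
      sq_le_sq' (abs_le.1 h3).1 (abs_le.1 h3).2
    have h7 : (16 * ‖a‖ * ((1 + ‖x‖) ^ 2)⁻¹) ^ 2 = 256 * ‖a‖ ^ 2 * ((1 + ‖x‖) ^ 4)⁻¹ := by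
      field_simp; ring
    linarith [hGnn x, hGnn (x - a)]

end SquareIntegrability

/-! ### Potentials of finitely many point charges -/

section NewtonSum

variable {n : ℕ} {z : Fin n → R3}

/-- The potential of point charges `q j` placed at the points `z j`. -/
noncomputable def newtonSum (z : Fin n → R3) (q : Fin n → ℂ) (x : R3) : ℂ :=
  ∑ j, q j * ((‖x - z j‖⁻¹ : ℝ) : ℂ)

theorem newtonSum_add (q q' : Fin n → ℂ) :
    newtonSum z (q + q') = newtonSum z q + newtonSum z q' := by
  ext x
  simp [newtonSum, add_mul, Finset.sum_add_distrib]

theorem newtonSum_smul (c : ℂ) (q : Fin n → ℂ) : newtonSum z (c • q) = c • newtonSum z q := by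
  ext x
  simp [newtonSum, mul_assoc, Finset.mul_sum]

/-- Neutrality allows subtracting `q j / |x|` from each term at no cost. -/
theorem memLp_newtonSum {q : Fin n → ℂ} (hq : ∑ j, q j = 0) :
    MemLp (newtonSum z q) 2 volume := by
  have h : newtonSum z q = fun x => ∑ j, q j * ((‖x - z j‖⁻¹ - ‖x‖⁻¹ : ℝ) : ℂ) := by
    ext x
    simp only [newtonSum, Complex.ofReal_sub, mul_sub, Finset.sum_sub_distrib, ← Finset.sum_mul,
      hq, zero_mul, sub_zero]
  rw [h]
  exact memLp_finsetSum _ fun j _ => ((memLp_inv_norm_sub_sub (z j)).ofReal).const_mul (q j)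

theorem harmonicAt_mul_inv_norm_sub (c : ℂ) {y x : R3} (hx : x ≠ y) :
    HarmonicAt (fun x : R3 => c * ((‖x - y‖⁻¹ : ℝ) : ℂ)) x :=
  (harmonicAt_inv_norm_sub hx).comp_CLM
    ((ContinuousLinearMap.mul ℝ ℂ c).comp Complex.ofRealCLM)

theorem harmonicOnNhd_newtonSum (q : Fin n → ℂ) :
    HarmonicOnNhd (newtonSum z q) (Set.range z)ᶜ := fun _ hx =>
  harmonicAt_finsetSum Finset.univ fun j _ =>
    harmonicAt_mul_inv_norm_sub (q j) fun h => hx ⟨j, h.symm⟩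

theorem tendsto_newtonSum_cobounded (q : Fin n → ℂ) :
    Tendsto (newtonSum z q) (Bornology.cobounded R3) (𝓝 0) := by
  have h (j : Fin n) : Tendsto (fun x : R3 => q j * ((‖x - z j‖⁻¹ : ℝ) : ℂ))
      (Bornology.cobounded R3) (𝓝 0) := by
    have h1 : Tendsto (fun x : R3 => ‖x - z j‖) (Bornology.cobounded R3) atTop := by
      refine tendsto_atTop_mono (fun x => norm_sub_norm_le x (z j)) ?_
      exact tendsto_atTop_add_const_right _ (-‖z j‖) tendsto_norm_cobounded_atTop
    have h2 := ((Complex.continuous_ofReal.tendsto 0).comp (tendsto_inv_atTop_zero.comp h1))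
    simpa using h2.const_mul (q j)
  have hsum := tendsto_finsetSum Finset.univ fun j _ => h j
  rwa [Finset.sum_const_zero] at hsum

/-- The expansion of `newtonSum z q` at the point `z k`. -/
theorem newtonSum_asymptotics (hz : Function.Injective z) (q : Fin n → ℂ) (k : Fin n) :
    (fun x : R3 => newtonSum z q x - (q k / (‖x - z k‖ : ℂ) +
      ∑ j ∈ Finset.univ.erase k, q j * ((‖z k - z j‖⁻¹ : ℝ) : ℂ)))
      =O[𝓝[≠] z k] fun x => ‖x - z k‖ := by
  set T : R3 → ℂ := fun x => ∑ j ∈ Finset.univ.erase k, q j * ((‖x - z j‖⁻¹ : ℝ) : ℂ) with hT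
  have hTd : DifferentiableAt ℝ T (z k) :=
    (harmonicAt_finsetSum _ fun j hj => harmonicAt_mul_inv_norm_sub (q j)
      fun h => Finset.ne_of_mem_erase hj (hz h).symm).1.differentiableAt two_ne_zero
  refine ((hTd.isBigO_sub.mono nhdsWithin_le_nhds).norm_right).congr_left fun x => ?_
  rw [newtonSum, ← Finset.add_sum_erase _ _ (Finset.mem_univ k)]
  simp only [hT]
  push_cast
  ring

theorem eventually_notMem_range (z : Fin n → R3) (k : Fin n) :
    ∀ᶠ x in 𝓝[≠] z k, x ∈ (Set.range z)ᶜ := by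
  have h : (Set.range z \ {z k})ᶜ ∈ 𝓝 (z k) :=
    ((Set.finite_range z).subset Set.sdiff_subset).isClosed.isOpen_compl.mem_nhds (by simp)
  filter_upwards [nhdsWithin_le_nhds h, self_mem_nhdsWithin] with x h1 h2 h3
  exact h1 ⟨h3, h2⟩

theorem tendsto_norm_sub_nhdsNE (y : R3) : Tendsto (fun x => ‖x - y‖) (𝓝[≠] y) (𝓝 0) := by
  have : Continuous fun x : R3 => ‖x - y‖ := by fun_prop
  simpa using (this.tendsto y).mono_left nhdsWithin_le_nhds

/-- The charge and the constant term are determined by the expansion at a point. -/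
theorem expansion_unique {y : R3} {a b : ℂ}
    (h : (fun x : R3 => a / (‖x - y‖ : ℂ) + b) =O[𝓝[≠] y] fun x => ‖x - y‖) :
    a = 0 ∧ b = 0 := by
  have h0 := h.trans_tendsto (tendsto_norm_sub_nhdsNE y)
  have hn : Tendsto (fun x : R3 => (‖x - y‖ : ℂ)) (𝓝[≠] y) (𝓝 0) := by
    exact_mod_cast (Complex.continuous_ofReal.tendsto 0).comp (tendsto_norm_sub_nhdsNE y)
  have ha : a = 0 := by
    have h1 : Tendsto (fun x : R3 => (‖x - y‖ : ℂ) * (a / (‖x - y‖ : ℂ) + b) - b * (‖x - y‖ : ℂ))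
        (𝓝[≠] y) (𝓝 0) := by
      simpa using (hn.mul h0).sub (hn.const_mul b)
    refine tendsto_nhds_unique (tendsto_const_nhds.congr' ?_) h1
    filter_upwards [self_mem_nhdsWithin] with x hx
    have : (‖x - y‖ : ℂ) ≠ 0 := by
      simpa [sub_eq_zero] using hx
    field_simp
    ring
  subst ha
  simp only [zero_div, zero_add] at h0
  exact ⟨rfl, tendsto_nhds_unique tendsto_const_nhds h0⟩

/-- Continuity upgrades a.e. vanishing to vanishing off the punctures, and each charge is the
singular coefficient at its point. -/
theorem newtonSum_ae_eq_zero (hz : Function.Injective z) {q : Fin n → ℂ}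
    (h : newtonSum z q =ᵐ[volume] 0) : q = 0 := by
  have hc : ContinuousOn (newtonSum z q) (Set.range z)ᶜ := (harmonicOnNhd_newtonSum q).continuousOn
  have h0 : Set.EqOn (newtonSum z q) 0 (Set.range z)ᶜ :=
    Measure.eqOn_open_of_ae_eq (ae_restrict_of_ae h) (isOpen_compl_range z) hc continuousOn_const
  funext k
  refine (expansion_unique (b := ∑ j ∈ Finset.univ.erase k, q j * ((‖z k - z j‖⁻¹ : ℝ) : ℂ))
    ((newtonSum_asymptotics hz q k).neg_left.congr' ?_ EventuallyEq.rfl)).1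
  filter_upwards [eventually_notMem_range z k] with x hx
  rw [h0 hx, Pi.zero_apply, zero_sub, neg_neg]

end NewtonSum

/-! ### Zero-energy solutions as charge distributions -/

section ZeroEnergy

variable {n : ℕ} {z : Fin n → R3} {α : Fin n → ℝ} {ψ : R3 → ℂ}

theorem IsSolution.harmonicOnNhd (h : IsSolution z α 0 ψ) : HarmonicOnNhd ψ (Set.range z)ᶜ := by
  intro x hx
  have hmem := (isOpen_compl_range z).mem_nhds hx
  refine ⟨h.contDiffOn.contDiffAt hmem, ?_⟩
  filter_upwards [hmem] with y hy
  simpa using h.free_eq y hy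

/-- A square-integrable solution at zero energy is a sum of point charges. -/
theorem IsSolution.exists_eqOn_newtonSum (hz : Function.Injective z) (h : IsSolution z α 0 ψ)
    (hL : MemLp ψ 2 volume) :
    ∃ q : Fin n → ℂ, Set.EqOn ψ (newtonSum z q) (Set.range z)ᶜ ∧
      ∀ k, ∑ j ∈ Finset.univ.erase k, q j * ((‖z k - z j‖⁻¹ : ℝ) : ℂ) =
        4 * (Real.pi : ℂ) * (α k : ℂ) * q k := by
  choose a b hab hb using h.asymptotics
  have hdiff (k) : (fun x => (ψ - newtonSum z a) x -
      (b k - ∑ j ∈ Finset.univ.erase k, a j * ((‖z k - z j‖⁻¹ : ℝ) : ℂ)))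
      =O[𝓝[≠] z k] fun x => ‖x - z k‖ := by
    refine ((hab k).sub (newtonSum_asymptotics hz a k)).congr_left fun x => ?_
    simp only [Pi.sub_apply]
    ring
  have hzero : ∀ x ∈ (Set.range z)ᶜ, (ψ - newtonSum z a) x = 0 := by
    intro x hx
    refine eq_zero_of_harmonicOnNhd_punctured (h.harmonicOnNhd.sub (harmonicOnNhd_newtonSum a))
      (fun k => ?_) ?_ hx
    · have h1 : (fun x : R3 => ‖x - z k‖) =O[𝓝[≠] z k] fun _ => (1 : ℝ) :=
        (tendsto_norm_sub_nhdsNE (z k)).isBigO_one ℝ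
      refine (((hdiff k).trans h1).add (isBigO_const_const
        (b k - ∑ j ∈ Finset.univ.erase k, a j * ((‖z k - z j‖⁻¹ : ℝ) : ℂ))
        (one_ne_zero : (1 : ℝ) ≠ 0) _)).congr_left fun x => ?_
      ring
    · have h1 := tendsto_cobounded_of_harmonicOnNhd_of_memLp
        (Set.finite_range z).isBounded h.harmonicOnNhd hL
      have h2 := h1.sub (tendsto_newtonSum_cobounded (z := z) a)
      rwa [sub_zero] at h2
  refine ⟨a, fun x hx => sub_eq_zero.1 (hzero x hx), fun k => ?_⟩
  rw [← hb k]
  -- As `ψ - newtonSum z a` vanishes off the punctures, the constant terms of the two expansions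
  -- agree.
  have h2 := expansion_unique (y := z k) (a := 0)
    (b := b k - ∑ j ∈ Finset.univ.erase k, a j * ((‖z k - z j‖⁻¹ : ℝ) : ℂ)) <| by
      refine (hdiff k).neg_left.congr' ?_ EventuallyEq.rfl
      filter_upwards [eventually_notMem_range z k] with x hx
      rw [hzero x hx]
      simp
  exact (sub_eq_zero.1 h2.2).symm

theorem isSolution_newtonSum (hz : Function.Injective z) {q : Fin n → ℂ}
    (hq : ∀ k, ∑ j ∈ Finset.univ.erase k, q j * ((‖z k - z j‖⁻¹ : ℝ) : ℂ) =
      4 * (Real.pi : ℂ) * (α k : ℂ) * q k) :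
    IsSolution z α 0 (newtonSum z q) where
  contDiffOn := (harmonicOnNhd_newtonSum q).contDiffOn
  free_eq x hx := by simp [(harmonicOnNhd_newtonSum q x hx).2.self_of_nhds]
  asymptotics k := ⟨q k, _, newtonSum_asymptotics hz q k, hq k⟩

end ZeroEnergy

/-! ### The tetrahedron and the dimension count -/

section Tetrahedron

variable {s : ℝ} {z : Fin 4 → R3}

/-- The right side is `-q k / s`, exactly the term that completes the sum over `j ≠ k`; the system
therefore has rank one. -/
theorem charge_condition_iff (hs : 0 < s) (hz : ∀ j j' : Fin 4, j ≠ j' → ‖z j - z j'‖ = s)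
    (q : Fin 4 → ℂ) (k : Fin 4) :
    ∑ j ∈ Finset.univ.erase k, q j * ((‖z k - z j‖⁻¹ : ℝ) : ℂ) =
      4 * (Real.pi : ℂ) * ((-(4 * Real.pi * s)⁻¹ : ℝ) : ℂ) * q k ↔ ∑ j, q j = 0 := by
  have h1 : ∑ j ∈ Finset.univ.erase k, q j * ((‖z k - z j‖⁻¹ : ℝ) : ℂ) =
      (∑ j ∈ Finset.univ.erase k, q j) * ((s⁻¹ : ℝ) : ℂ) := by
    rw [Finset.sum_mul]
    refine Finset.sum_congr rfl fun j hj => ?_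
    rw [hz k j (Finset.ne_of_mem_erase hj).symm]
  have hs' : (s : ℂ) ≠ 0 := by exact_mod_cast hs.ne'
  have hπ : (Real.pi : ℂ) ≠ 0 := by exact_mod_cast Real.pi_ne_zero
  have h2 : 4 * (Real.pi : ℂ) * ((-(4 * Real.pi * s)⁻¹ : ℝ) : ℂ) * q k =
      -q k * ((s⁻¹ : ℝ) : ℂ) := by
    push_cast
    field_simp
  rw [h1, h2, mul_left_inj' (by simpa using hs'), ← Finset.add_sum_erase _ _ (Finset.mem_univ k),
    eq_neg_iff_add_eq_zero, add_comm]

/-- The total charge. -/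
noncomputable def totalCharge : (Fin 4 → ℂ) →ₗ[ℂ] ℂ := ∑ j, LinearMap.proj j

theorem totalCharge_apply (q : Fin 4 → ℂ) : totalCharge q = ∑ j, q j := by
  simp [totalCharge]

theorem finrank_ker_totalCharge : Module.finrank ℂ (LinearMap.ker totalCharge) = 3 := by
  have hne : totalCharge ≠ 0 := fun h => by
    have := DFunLike.congr_fun h (Pi.single 0 1)
    simp [totalCharge_apply] at this
  have := Module.Dual.finrank_ker_add_one_of_ne_zero hne
  rw [Module.finrank_fin_fun] at this
  omega

/-- Neutral charge distributions, mapped to the classes of their potentials in `L²`. -/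
noncomputable def newtonLp (z : Fin 4 → R3) :
    LinearMap.ker totalCharge →ₗ[ℂ] Lp ℂ 2 (volume : Measure R3) where
  toFun q := (memLp_newtonSum (z := z) ((totalCharge_apply q.1).symm.trans q.2)).toLp
  map_add' q q' := by
    rw [← MemLp.toLp_add]
    exact MemLp.toLp_congr _ _ (Eventually.of_forall fun x => congrFun (newtonSum_add _ _) x)
  map_smul' c q := by
    rw [RingHom.id_apply, ← MemLp.toLp_const_smul]
    exact MemLp.toLp_congr _ _ (Eventually.of_forall fun x => congrFun (newtonSum_smul _ _) x)

theorem coeFn_newtonLp (q : LinearMap.ker totalCharge) :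
    newtonLp z q =ᵐ[volume] newtonSum z q.1 :=
  (memLp_newtonSum ((totalCharge_apply q.1).symm.trans q.2)).coeFn_toLp

theorem newtonLp_injective (hz : Function.Injective z) : Function.Injective (newtonLp z) := by
  rw [← LinearMap.ker_eq_bot, LinearMap.ker_eq_bot']
  intro q hq
  have h := coeFn_newtonLp (z := z) q
  rw [hq] at h
  exact Subtype.ext (newtonSum_ae_eq_zero hz (h.symm.trans (Lp.coeFn_zero ℂ 2 volume)))

theorem range_newtonLp (hs : 0 < s) (hz : ∀ j j' : Fin 4, j ≠ j' → ‖z j - z j'‖ = s)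
    (hinj : Function.Injective z) :
    LinearMap.range (newtonLp z) = boundStates z (fun _ => -(4 * Real.pi * s)⁻¹) 0 := by
  ext f
  constructor
  · rintro ⟨q, rfl⟩
    exact ⟨newtonSum z q.1, isSolution_newtonSum hinj fun k => (charge_condition_iff hs hz _ k).2
      ((totalCharge_apply q.1).symm.trans q.2), coeFn_newtonLp q⟩
  · rintro ⟨ψ, hψ, hf⟩
    obtain ⟨q, hq, hcond⟩ := hψ.exists_eqOn_newtonSum hinj ((memLp_congr_ae hf).1 (Lp.memLp f))
    -- The equations coincide, so the one at index 0 suffices.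
    refine ⟨⟨q, (totalCharge_apply q).trans ((charge_condition_iff hs hz q 0).1 (hcond 0))⟩, ?_⟩
    refine Lp.ext ((coeFn_newtonLp _).trans (EventuallyEq.trans ?_ hf.symm))
    filter_upwards [(Set.finite_range z).countable.ae_notMem volume] with x hx
    exact (hq hx).symm

end Tetrahedron

end PointScatterers

theorem mainTheorem3 (s : ℝ) (hs : 0 < s) (z : Fin 4 → PointScatterers.R3)
    (hz : ∀ j j' : Fin 4, j ≠ j' → ‖z j - z j'‖ = s) :
    Module.finrank ℂ
      (PointScatterers.boundStates z (fun _ => -(4 * Real.pi * s)⁻¹) 0) = 3 := by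
  have hinj : Function.Injective z := fun j j' h => by
    by_contra hne
    have := hz j j' hne
    rw [h, sub_self, norm_zero] at this
    exact hs.ne this
  rw [← PointScatterers.range_newtonLp hs hz hinj,
    LinearMap.finrank_range_of_inj (PointScatterers.newtonLp_injective hinj),
    PointScatterers.finrank_ker_totalCharge]
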